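/- Let $n_1,n_2\ge 1$ and let $K_{n_1,n_2}$ be the complete bipartite graph with bipartition $(X_1,X_2)$, where $|X_1|=n_1$ and $|X_2|=n_2$. Let $F$ be a spanning forest of $K_{n_1,n_2}$ (that is, an acyclic subgraph, possibly without edges, whose vertex set is $X_1\cup X_2$), and let $T_1,\dots,T_c$ be its connected components. For $i\in\{1,2\}$ and $1\le p\le c$ put $n_{ip}=|X_i\cap V(T_p)|$. Let $\tau_F(K_{n_1,n_2})$ denote the number of spanning trees of $K_{n_1,n_2}$ that contain all edges of $F$. Then $$\tau_F(K_{n_1,n_2})=\frac{1}{n_1n_2}\left(\prod_{p=1}^{c}\left(n_{1p}n_2+n_{2p}n_1\right)\right)\left(1-\sum_{p=1}^{c}\frac{n_{1p}n_{2p}}{n_{1p}n_2+n_{2p}n_1}\right).$$ -/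

import Mathlib

/-- The set of spanning trees of `G` that contain all edges of `F`. A `SimpleGraph` on the vertex
type `V` has all of `V` as its vertex set, so every subgraph `T ≤ G` of this kind is spanning. -/
def spanningTreesContaining {V : Type*} (G F : SimpleGraph V) : Set (SimpleGraph V) :=
  {T | T ≤ G ∧ F ≤ T ∧ T.IsTree}

/-- The number of spanning trees of `G` containing `F`. -/
noncomputable def numSpanningTreesContaining {V : Type*} (G F : SimpleGraph V) : ℕ :=
  (spanningTreesContaining G F).ncard

/-- A spanning forest of `G`: an acyclic subgraph of `G` on the whole vertex set
(not necessarily connected or maximal; isolated vertices are allowed). -/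
def IsSpanningForest {V : Type*} (G F : SimpleGraph V) : Prop :=
  F ≤ G ∧ F.IsAcyclic

/-- The number of vertices of the component `T` lying in the vertex class `X`. -/
noncomputable def numVertsIn {V : Type*} {F : SimpleGraph V} (X : Set V)
    (T : F.ConnectedComponent) : ℕ :=
  (X ∩ T.supp).ncard

/-! The proof inducts on the number c of components of F, by double counting. A spanning tree
containing F has exactly c - 1 edges between different components (`card_crossingEdges_add_one`).
Counting pairs (tree, such an edge) shows that (c - 1) τ_F is the sum of τ_{F+e} over the edges e of
K joining different components. Each F+e is a forest with c - 1 components, and its count depends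
only on the two components that e merges. The closed form satisfies the same recursion
(`sum_mul_treeFormula_mergeAt`), and for c = 1 both sides are 1.

Components are tracked by labels in a fixed type, so that adding an edge just erases one label. -/

/-! ### Component labelings and merging. -/

/-- `π` labels the vertices by the elements of `s`, two vertices having the same label if and only
if they lie in the same component of `F`. -/
structure IsComponentLabeling {V ι : Type*} (F : SimpleGraph V) (s : Finset ι) (π : V → ι) :
    Prop where
  range_eq : Set.range π = s
  eq_iff : ∀ u v, π u = π v ↔ F.Reachable u v

/-- The labeling obtained from `π` by replacing the label `q` by `p`. -/
noncomputable def mergeLabel {V ι : Type*} (π : V → ι) (p q : ι) (w : V) : ι :=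
  open Classical in if π w = q then p else π w

namespace IsComponentLabeling

variable {V ι : Type*} {F : SimpleGraph V} {s : Finset ι} {π : V → ι}

theorem mem (h : IsComponentLabeling F s π) (v : V) : π v ∈ s := by
  have : π v ∈ Set.range π := ⟨v, rfl⟩
  rwa [h.range_eq] at this

theorem exists_eq (h : IsComponentLabeling F s π) {i : ι} (hi : i ∈ s) : ∃ v, π v = i := by
  have : i ∈ Set.range π := by rw [h.range_eq]; exact hi
  exact this

theorem eq_of_card_le_one (h : IsComponentLabeling F s π) (hs : s.card ≤ 1) (u v : V) :
    π u = π v :=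
  Finset.card_le_one.1 hs _ (h.mem u) _ (h.mem v)

open Classical in
theorem merge (h : IsComponentLabeling F s π) {u v : V} (huv : π u ≠ π v) :
    IsComponentLabeling (F ⊔ SimpleGraph.edge u v) (s.erase (π v))
      (mergeLabel π (π u) (π v)) where
  range_eq := by
    ext i
    simp only [Set.mem_range, Finset.coe_erase, Set.mem_sdiff, Set.mem_singleton_iff,
      Finset.mem_coe]
    constructor
    · rintro ⟨w, rfl⟩
      unfold mergeLabel
      split_ifs with hw
      · exact ⟨h.mem u, huv⟩
      · exact ⟨h.mem w, hw⟩
    · rintro ⟨hi, hne⟩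
      obtain ⟨w, rfl⟩ := h.exists_eq hi
      exact ⟨w, if_neg hne⟩
  eq_iff := by
    have hne : u ≠ v := fun e => huv (by rw [e])
    have hr : (F ⊔ SimpleGraph.edge u v).Reachable u v := by
      apply SimpleGraph.Adj.reachable
      simp [SimpleGraph.edge_adj, hne]
    have key : ∀ x, (F ⊔ SimpleGraph.edge u v).Reachable x (if π x = π v then u else x) := by
      intro x
      split_ifs with hx
      · exact (((h.eq_iff x v).1 hx).mono le_sup_left).trans hr.symm
      · rfl
    have lab : ∀ x, mergeLabel π (π u) (π v) x = π (if π x = π v then u else x) := by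
      intro x; unfold mergeLabel; split_ifs <;> rfl
    intro x y
    constructor
    · intro e
      rw [lab, lab, h.eq_iff] at e
      exact (key x).trans ((e.mono le_sup_left).trans (key y).symm)
    · rintro ⟨p⟩
      induction p with
      | nil => rfl
      | cons hadj _ ih =>
        rw [← ih]
        rcases hadj with hadj | hadj
        · have := (h.eq_iff _ _).2 hadj.reachable
          simp [mergeLabel, this]
        · rw [SimpleGraph.edge_adj] at hadj
          rcases hadj with ⟨⟨rfl, rfl⟩ | ⟨rfl, rfl⟩, _⟩ <;> simp [mergeLabel]

end IsComponentLabeling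

/-- Every edge of a forest T is a bridge, so an F-path between its ends must use the edge itself. -/
theorem SimpleGraph.IsAcyclic.adj_of_le_of_reachable {V : Type*} {F T : SimpleGraph V}
    (hT : T.IsAcyclic) (hle : F ≤ T) {u v : V} (hadj : T.Adj u v) (hr : F.Reachable u v) :
    F.Adj u v := by
  by_contra hF
  have hb := SimpleGraph.isAcyclic_iff_forall_adj_isBridge.1 hT hadj
  rw [SimpleGraph.isBridge_iff] at hb
  refine hb (hr.mono fun x y hxy => ?_)
  rw [SimpleGraph.deleteEdges_adj]
  refine ⟨hle hxy, fun e => hF ?_⟩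
  rw [Set.mem_singleton_iff] at e
  rwa [← SimpleGraph.mem_edgeSet, ← e, SimpleGraph.mem_edgeSet]

/-! ### Double counting of trees and crossing edges. -/

section Bipartite

variable {V₁ V₂ ι : Type*} [Fintype V₁] [Fintype V₂]

open Classical in
/-- The edges of `T` between vertices with distinct labels. -/
noncomputable def crossingEdges (π : V₁ ⊕ V₂ → ι) (T : SimpleGraph (V₁ ⊕ V₂)) :
    Finset (V₁ × V₂) :=
  {e | T.Adj (Sum.inl e.1) (Sum.inr e.2) ∧ π (Sum.inl e.1) ≠ π (Sum.inr e.2)}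

theorem mem_crossingEdges {π : V₁ ⊕ V₂ → ι} {T : SimpleGraph (V₁ ⊕ V₂)} {e : V₁ × V₂} :
    e ∈ crossingEdges π T ↔
      T.Adj (Sum.inl e.1) (Sum.inr e.2) ∧ π (Sum.inl e.1) ≠ π (Sum.inr e.2) := by
  simp [crossingEdges]

theorem exists_adj_label_ne {V : Type*} {T : SimpleGraph V} (hT : T.Preconnected)
    {π : V → ι} {u v : V} (huv : π u ≠ π v) : ∃ x y, T.Adj x y ∧ π x ≠ π y := by
  by_contra! hcon
  obtain ⟨p⟩ := hT u v
  apply huv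
  induction p with
  | nil => rfl
  | cons hadj _ ih => rw [hcon _ _ hadj]; by_contra hne; exact hne (ih hne)

/-- Induction on the number of labels: adding one crossing edge of T to F merges two labels, and
that edge alone stops crossing. Any other would have its ends joined in the enlarged forest, hence
would already lie in F. -/
theorem card_crossingEdges_add_one {T : SimpleGraph (V₁ ⊕ V₂)}
    (hTK : T ≤ completeBipartiteGraph V₁ V₂) (hT : T.IsTree)
    {F : SimpleGraph (V₁ ⊕ V₂)} (hFT : F ≤ T) {s : Finset ι} {π : V₁ ⊕ V₂ → ι}
    (h : IsComponentLabeling F s π) : (crossingEdges π T).card + 1 = s.card := by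
  classical
  obtain ⟨n, hn⟩ : ∃ n, s.card = n := ⟨_, rfl⟩
  induction n generalizing F s π with
  | zero =>
    obtain ⟨v⟩ := hT.connected.nonempty
    have := h.mem v
    simp_all
  | succ n ih =>
    rcases Nat.eq_zero_or_pos n with rfl | hpos
    · have : crossingEdges π T = ∅ := by
        ext e
        simp [mem_crossingEdges, h.eq_of_card_le_one hn.le (Sum.inl e.1) (Sum.inr e.2)]
      simp [this, hn]
    · obtain ⟨i, hi, j, hj, hij⟩ := Finset.one_lt_card.1 (by omega : 1 < s.card)
      obtain ⟨u, rfl⟩ := h.exists_eq hi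
      obtain ⟨v, rfl⟩ := h.exists_eq hj
      obtain ⟨x, y, hadj, hne⟩ : ∃ x y, T.Adj (Sum.inl x) (Sum.inr y) ∧
          π (Sum.inl x) ≠ π (Sum.inr y) := by
        obtain ⟨x, y, hadj, hne⟩ := exists_adj_label_ne hT.connected.preconnected hij
        have hK := hTK hadj
        rcases x with x | x <;> rcases y with y | y <;> simp at hK
        · exact ⟨x, y, hadj, hne⟩
        · exact ⟨y, x, hadj.symm, hne.symm⟩
      have hm := h.merge hne
      have hle : F ⊔ SimpleGraph.edge (Sum.inl x) (Sum.inr y) ≤ T :=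
        sup_le hFT ((SimpleGraph.edge_le_iff _).2 (Or.inr hadj))
      have hcard : (s.erase (π (Sum.inr y))).card = n := by
        rw [Finset.card_erase_of_mem (h.mem _), hn]; rfl
      have hrec := ih hle hm hcard
      have heq : crossingEdges π T =
          insert (x, y) (crossingEdges (mergeLabel π (π (Sum.inl x)) (π (Sum.inr y))) T) := by
        ext ⟨a, b⟩
        rw [Finset.mem_insert, mem_crossingEdges, mem_crossingEdges]
        constructor
        · rintro ⟨h1, h2⟩
          by_cases hlab : mergeLabel π (π (Sum.inl x)) (π (Sum.inr y)) (Sum.inl a) =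
              mergeLabel π (π (Sum.inl x)) (π (Sum.inr y)) (Sum.inr b)
          · left
            have := hT.isAcyclic.adj_of_le_of_reachable hle h1 ((hm.eq_iff _ _).1 hlab)
            rcases this with h3 | h3
            · exact absurd ((h.eq_iff _ _).2 h3.reachable) h2
            · simpa [SimpleGraph.edge_adj] using h3
          · exact Or.inr ⟨h1, hlab⟩
        · rintro (e | ⟨h1, h2⟩)
          · obtain ⟨rfl, rfl⟩ := Prod.mk.inj e
            exact ⟨hadj, hne⟩
          · exact ⟨h1, fun e => h2 (by simp only [mergeLabel, e])⟩
      rw [heq, Finset.card_insert_of_notMem, hrec, hcard, hn]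
      simp [mem_crossingEdges, mergeLabel]

theorem spanningTreesContaining_sup_edge {V : Type*} (G F : SimpleGraph V) {u v : V}
    (huv : u ≠ v) :
    spanningTreesContaining G (F ⊔ SimpleGraph.edge u v) =
      {T ∈ spanningTreesContaining G F | T.Adj u v} := by
  ext T
  simp only [spanningTreesContaining, Set.mem_ofPred_eq, sup_le_iff, SimpleGraph.edge_le_iff, huv,
    false_or]
  tauto

open Classical in
theorem card_sub_one_mul_numSpanningTreesContaining {F : SimpleGraph (V₁ ⊕ V₂)} {s : Finset ι}
    {π : V₁ ⊕ V₂ → ι} (h : IsComponentLabeling F s π) :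
    ((s.card : ℚ) - 1) * numSpanningTreesContaining (completeBipartiteGraph V₁ V₂) F =
      ∑ x, ∑ y, if π (Sum.inl x) = π (Sum.inr y) then 0 else
        (numSpanningTreesContaining (completeBipartiteGraph V₁ V₂)
          (F ⊔ SimpleGraph.edge (Sum.inl x) (Sum.inr y)) : ℚ) := by
  set K := completeBipartiteGraph V₁ V₂
  let S : Finset (SimpleGraph (V₁ ⊕ V₂)) := {T | T ∈ spanningTreesContaining K F}
  have hS : numSpanningTreesContaining K F = S.card := by
    rw [numSpanningTreesContaining, ← Set.ncard_coe_finset]; simp [S]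
  have hS' : ∀ x y, numSpanningTreesContaining K
      (F ⊔ SimpleGraph.edge (Sum.inl x) (Sum.inr y)) =
      ∑ T ∈ S, if T.Adj (Sum.inl x) (Sum.inr y) then 1 else 0 := by
    intro x y
    rw [numSpanningTreesContaining, spanningTreesContaining_sup_edge _ _ (by simp),
      ← Finset.card_filter, ← Set.ncard_coe_finset]
    simp [S]
  have hT : ∀ T ∈ S, ((s.card : ℚ) - 1) = ∑ x, ∑ y, if π (Sum.inl x) = π (Sum.inr y) then 0 else
      if T.Adj (Sum.inl x) (Sum.inr y) then 1 else 0 := by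
    intro T hT
    obtain ⟨h1, h2, h3⟩ : T ∈ spanningTreesContaining K F := by simpa [S] using hT
    rw [← card_crossingEdges_add_one h1 h3 h2 h, crossingEdges, Finset.card_filter,
      Fintype.sum_prod_type]
    push_cast
    rw [add_sub_cancel_right]
    refine Finset.sum_congr rfl fun x _ => Finset.sum_congr rfl fun y _ => ?_
    split_ifs <;> simp_all
  rw [hS, mul_comm, ← nsmul_eq_mul, ← Finset.sum_const, Finset.sum_congr rfl hT, Finset.sum_comm]
  refine Finset.sum_congr rfl fun x _ => ?_
  rw [Finset.sum_comm]
  refine Finset.sum_congr rfl fun y _ => ?_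
  split_ifs
  · simp
  · rw [hS']; push_cast; rfl

theorem numSpanningTreesContaining_of_isTree {V : Type*} {G F : SimpleGraph V} (hle : F ≤ G)
    (hF : F.IsTree) : numSpanningTreesContaining G F = 1 := by
  rw [numSpanningTreesContaining, Set.ncard_eq_one]
  refine ⟨F, Set.eq_singleton_iff_unique_mem.2 ⟨⟨hle, le_rfl, hF⟩, ?_⟩⟩
  rintro T ⟨-, h2, h3⟩
  exact le_antisymm (fun u v huv =>
    h3.isAcyclic.adj_of_le_of_reachable h2 huv (hF.connected.preconnected u v)) h2

end Bipartite

/-! ### The recursion for the closed form. -/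

section Identity

variable {ι : Type*} (M N : ℚ) (s : Finset ι) (a b : ι → ℚ)

/-- The closed form for the number of spanning trees, in terms of the numbers `a i` and `b i` of
vertices of the `i`-th component in the two classes, of sizes `M` and `N`. -/
def treeFormula : ℚ :=
  1 / (M * N) * (∏ i ∈ s, (a i * N + b i * M)) *
    (1 - ∑ i ∈ s, a i * b i / (a i * N + b i * M))

/-- Merging the entry at `q` into the entry at `p`. -/
noncomputable def mergeAt (a : ι → ℚ) (p q : ι) (i : ι) : ℚ :=
  open Classical in if i = p then a p + a q else a i

variable {M N s a b}

-- The weights w_i = a_i N + b_i M are additive, so merging multiplies their product by 1/w_p +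
-- 1/w_q. The new summand has denominator w_p + w_q, which this factor cancels.
open Classical in
theorem treeFormula_mergeAt (hw : ∀ i ∈ s, 0 < a i * N + b i * M) {p q : ι} (hp : p ∈ s)
    (hq : q ∈ s) (hpq : p ≠ q) :
    treeFormula M N (s.erase q) (mergeAt a p q) (mergeAt b p q) =
      1 / (M * N) * (∏ i ∈ s, (a i * N + b i * M)) *
      ((1 / (a p * N + b p * M) + 1 / (a q * N + b q * M)) *
        (1 - ∑ i ∈ s, a i * b i / (a i * N + b i * M) + a p * b p / (a p * N + b p * M)
          + a q * b q / (a q * N + b q * M)) -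
        (a p + a q) * (b p + b q) / ((a p * N + b p * M) * (a q * N + b q * M))) := by
  have hp' : p ∈ s.erase q := Finset.mem_erase.2 ⟨hpq, hp⟩
  have hwp := hw p hp
  have hwq := hw q hq
  have hne : ∀ i ∈ (s.erase q).erase p, i ≠ p := fun i hi => (Finset.mem_erase.1 hi).1
  unfold treeFormula
  rw [← Finset.mul_prod_erase s _ hq, ← Finset.mul_prod_erase (s.erase q) _ hp',
    ← Finset.mul_prod_erase (s.erase q) _ hp',
    ← Finset.add_sum_erase s _ hq, ← Finset.add_sum_erase (s.erase q) _ hp',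
    ← Finset.add_sum_erase (s.erase q) _ hp',
    Finset.prod_congr rfl (g := fun i => a i * N + b i * M)
      (fun i hi => by simp [mergeAt, hne i hi]),
    Finset.sum_congr rfl (g := fun i => a i * b i / (a i * N + b i * M))
      (fun i hi => by simp [mergeAt, hne i hi])]
  simp only [mergeAt, if_true]
  generalize ∏ i ∈ (s.erase q).erase p, (a i * N + b i * M) = P
  generalize ∑ i ∈ (s.erase q).erase p, a i * b i / (a i * N + b i * M) = S
  have hsum : (a p + a q) * N + (b p + b q) * M =
    (a p * N + b p * M) + (a q * N + b q * M) := by ring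
  rw [hsum]
  generalize a p * N + b p * M = x at *
  generalize a q * N + b q * M = y at *
  generalize 1 / (M * N) = c
  have : x + y ≠ 0 := by positivity
  field_simp
  ring

open Classical in
theorem sum_mul_treeFormula_mergeAt (hM : M ≠ 0) (hN : N ≠ 0)
    (hw : ∀ i ∈ s, 0 < a i * N + b i * M)
    (ha : ∑ i ∈ s, a i = M) (hb : ∑ i ∈ s, b i = N) :
    (∑ p ∈ s, ∑ q ∈ s, a p * (b q * if p = q then 0 else
      treeFormula M N (s.erase q) (mergeAt a p q) (mergeAt b p q))) =
      ((s.card : ℚ) - 1) * treeFormula M N s a b := by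
  set S := ∑ i ∈ s, a i * b i / (a i * N + b i * M) with hS
  set C := 1 / (M * N) * (∏ i ∈ s, (a i * N + b i * M)) with hC
  let w : ι → ℚ := fun i => a i * N + b i * M
  let x : ι → ℚ := fun i => a i / w i
  let y : ι → ℚ := fun i => b i / w i
  let z : ι → ℚ := fun i => a i * b i / w i
  have hz : ∑ i ∈ s, z i = S := rfl
  have hw0 : ∀ i ∈ s, w i ≠ 0 := fun i hi => (hw i hi).ne'
  have hxy : ∀ i ∈ s, N * x i + M * y i = 1 := by
    intro i hi
    have := hw0 i hi
    simp only [x, y]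
    field_simp
    simp only [w]; ring
  have hxb : ∀ i, x i * b i = z i := fun i => by simp only [x, z]; ring
  have hya : ∀ i, a i * y i = z i := fun i => by simp only [y, z]; ring
  -- At p = q the general expression equals 2 z_p (1 - S), since x_p y_p a_p b_p = z_p²; subtracting
  -- it allows summing over all pairs.
  have hterm : ∀ p ∈ s, ∀ q ∈ s, (a p * (b q * if p = q then 0 else
      treeFormula M N (s.erase q) (mergeAt a p q) (mergeAt b p q))) =
      C * ((x p * b q + a p * y q) * (1 - S + z p + z q)
        - x p * y q * ((a p + a q) * (b p + b q))
        - if p = q then 2 * z p * (1 - S) else 0) := by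
    intro p hp q hq
    have h1 := hw0 p hp
    have h2 := hw0 q hq
    split_ifs with hpq
    · subst hpq
      simp only [x, y, z]
      field_simp
      ring
    · rw [treeFormula_mergeAt hw hp hq hpq, ← hS, ← hC]
      change a p * (b q * (C * ((1 / w p + 1 / w q) * (1 - S + a p * b p / w p + a q * b q / w q)
        - (a p + a q) * (b p + b q) / (w p * w q)))) = _
      simp only [x, y, z]
      field_simp
      ring
  rw [Finset.sum_congr rfl fun p hp => Finset.sum_congr rfl (hterm p hp)]
  -- Multiply `hxy` by a_i and sum; `hY` is the same with b_i.
  have hX : N * ∑ i ∈ s, x i * a i = M * (1 - S) := by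
    have : ∀ i ∈ s, N * (x i * a i) = a i - M * z i := by
      intro i hi
      rw [← hya]
      linear_combination a i * hxy i hi
    rw [Finset.mul_sum, Finset.sum_congr rfl this, Finset.sum_sub_distrib, ha, ← Finset.mul_sum,
      hz]
    ring
  have hY : M * ∑ i ∈ s, y i * b i = N * (1 - S) := by
    have : ∀ i ∈ s, M * (y i * b i) = b i - N * z i := by
      intro i hi
      rw [← hxb]
      linear_combination b i * hxy i hi
    rw [Finset.mul_sum, Finset.sum_congr rfl this, Finset.sum_sub_distrib, hb, ← Finset.mul_sum,
      hz]
    ring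
  have hXY : (∑ i ∈ s, x i * a i) * (∑ i ∈ s, y i * b i) = (1 - S) ^ 2 := by
    apply mul_left_cancel₀ (mul_ne_zero hN hM)
    linear_combination (M * ∑ i ∈ s, y i * b i) * hX + M * (1 - S) * hY
  have hone : N * ∑ i ∈ s, x i + M * ∑ i ∈ s, y i = s.card := by
    rw [Finset.mul_sum, Finset.mul_sum, ← Finset.sum_add_distrib, Finset.sum_congr rfl hxy]
    simp
  have hzz : N * ∑ i ∈ s, x i * z i + M * ∑ i ∈ s, y i * z i = S := by
    rw [Finset.mul_sum, Finset.mul_sum, ← Finset.sum_add_distrib, ← hz]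
    refine Finset.sum_congr rfl fun i hi => ?_
    linear_combination z i * hxy i hi
  -- summing over the second index
  have hinner : ∀ p ∈ s, (∑ q ∈ s, C * ((x p * b q + a p * y q) * (1 - S + z p + z q)
        - x p * y q * ((a p + a q) * (b p + b q))
        - if p = q then 2 * z p * (1 - S) else 0)) =
      C * ((1 - S) * N * x p + N * (x p * z p) + (1 - S) * (∑ q ∈ s, y q) * a p
        + (∑ q ∈ s, y q * z q) * a p
        - (∑ q ∈ s, y q * b q) * (x p * a p) - S * z p - 2 * (1 - S) * z p) := by
    intro p hp
    have : ∀ q ∈ s, C * ((x p * b q + a p * y q) * (1 - S + z p + z q)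
        - x p * y q * ((a p + a q) * (b p + b q))
        - if p = q then 2 * z p * (1 - S) else 0) =
        C * ((1 - S + z p) * x p * b q + x p * (b q * z q) + (1 - S + z p) * a p * y q
          + a p * (y q * z q) - a p * z p * y q - x p * a p * (y q * b q) - z p * z q
          - x p * (b q * z q)
          - if p = q then 2 * z p * (1 - S) else 0) := by
      intro q _
      congr 2
      linear_combination (-(y q * a p) - a q * y q) * hxb p - z p * hya q - x p * b q * hya q
    rw [Finset.sum_congr rfl this, ← Finset.mul_sum]
    simp only [Finset.sum_sub_distrib, Finset.sum_add_distrib, ← Finset.mul_sum,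
      Finset.sum_ite_eq, hp, if_true, hb, hz]
    ring
  rw [Finset.sum_congr rfl hinner, ← Finset.mul_sum]
  simp only [Finset.sum_sub_distrib, Finset.sum_add_distrib, ← Finset.mul_sum, ha, hz]
  have hf : treeFormula M N s a b = C * (1 - S) := rfl
  rw [hf]
  -- The total is C ((1 - S) c + S - (1 - S)² - S² - 2S(1 - S)), which is C (1 - S)(c - 1).
  linear_combination C * ((1 - S) * hone + hzz - hXY)

end Identity

/-! ### Fibre sizes and the induction on components. -/

section Count

variable {V₁ V₂ ι : Type*} [Fintype V₁] [Fintype V₂]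

open Classical in
/-- The size of the fibre of `f` over `i`, as a rational number. -/
noncomputable def fiberCard {α : Type*} [Fintype α] (f : α → ι) (i : ι) : ℚ :=
  (Finset.card {x | f x = i} : ℕ)

theorem sum_comp_eq_sum_fiberCard_mul {α : Type*} [Fintype α] (f : α → ι) {s : Finset ι}
    (hf : ∀ x, f x ∈ s) (g : ι → ℚ) : ∑ x, g (f x) = ∑ i ∈ s, fiberCard f i * g i := by
  classical
  rw [← Finset.sum_fiberwise_of_maps_to (t := s) (g := f) (fun x _ => hf x)]
  refine Finset.sum_congr rfl fun i _ => ?_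
  rw [Finset.sum_congr rfl (g := fun _ => g i)
    (fun x hx => by rw [(Finset.mem_filter.1 hx).2]), Finset.sum_const, nsmul_eq_mul, fiberCard]

theorem sum_fiberCard {α : Type*} [Fintype α] (f : α → ι) {s : Finset ι}
    (hf : ∀ x, f x ∈ s) : ∑ i ∈ s, fiberCard f i = Fintype.card α := by
  simpa using (sum_comp_eq_sum_fiberCard_mul f hf fun _ => 1).symm

/-- The label q must be excluded: its fibre becomes empty, while `mergeAt` leaves its entry
unchanged. -/
theorem fiberCard_mergeLabel {α β : Type*} [Fintype α] (π : β → ι) (f : α → β) {p q i : ι}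
    (hpq : p ≠ q) (hi : i ≠ q) :
    fiberCard (fun x => mergeLabel π p q (f x)) i = mergeAt (fiberCard fun x => π (f x)) p q i := by
  classical
  simp only [fiberCard, mergeAt]
  split_ifs with h
  · subst h
    rw [← Nat.cast_add, ← Finset.card_union_of_disjoint]
    · congr 2
      ext x
      simp only [Finset.mem_filter, Finset.mem_univ, true_and, Finset.mem_union]
      unfold mergeLabel
      split_ifs with hx <;> simp [hx]
    · rw [Finset.disjoint_left]
      intro x hx hx'
      simp only [Finset.mem_filter, Finset.mem_univ, true_and] at hx hx'
      exact hpq (hx.symm.trans hx')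
  · congr 2
    ext x
    simp only [Finset.mem_filter, Finset.mem_univ, true_and]
    unfold mergeLabel
    split_ifs with hx
    · rw [hx]; exact ⟨fun e => absurd e.symm h, fun e => absurd e.symm hi⟩
    · rfl

theorem fiberCard_nonneg {α : Type*} [Fintype α] (f : α → ι) (i : ι) : 0 ≤ fiberCard f i :=
  Nat.cast_nonneg _

theorem fiberCard_pos {α : Type*} [Fintype α] (f : α → ι) (x : α) : 0 < fiberCard f (f x) := by
  classical
  exact Nat.cast_pos.2 (Finset.card_pos.2 ⟨x, by simp⟩)

theorem numSpanningTreesContaining_eq_treeFormula [Nonempty V₁] [Nonempty V₂]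
    {F : SimpleGraph (V₁ ⊕ V₂)} (hle : F ≤ completeBipartiteGraph V₁ V₂) (hF : F.IsAcyclic)
    {s : Finset ι} {π : V₁ ⊕ V₂ → ι} (h : IsComponentLabeling F s π) :
    (numSpanningTreesContaining (completeBipartiteGraph V₁ V₂) F : ℚ) =
      treeFormula (Fintype.card V₁) (Fintype.card V₂) s (fiberCard fun x => π (Sum.inl x))
        (fiberCard fun y => π (Sum.inr y)) := by
  classical
  obtain ⟨n, hn⟩ : ∃ n, s.card = n := ⟨_, rfl⟩
  have hM : (0 : ℚ) < Fintype.card V₁ := Nat.cast_pos.2 Fintype.card_pos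
  have hN : (0 : ℚ) < Fintype.card V₂ := Nat.cast_pos.2 Fintype.card_pos
  induction n generalizing F s π with
  | zero =>
    have := h.mem (Sum.inl (Classical.arbitrary V₁))
    simp_all
  | succ n ih =>
    have ha := sum_fiberCard (fun x => π (Sum.inl x : V₁ ⊕ V₂)) (s := s) fun x => h.mem _
    have hb := sum_fiberCard (fun x => π (Sum.inr x : V₁ ⊕ V₂)) (s := s) fun x => h.mem _
    rcases Nat.eq_zero_or_pos n with rfl | hpos
    · have htree : F.IsTree :=
        { connected :=
            { preconnected := fun u v => (h.eq_iff u v).1 (h.eq_of_card_le_one hn.le u v)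
              nonempty := inferInstance }
          isAcyclic := hF }
      rw [numSpanningTreesContaining_of_isTree hle htree]
      obtain ⟨i, rfl⟩ := Finset.card_eq_one.1 hn
      rw [Finset.sum_singleton] at ha hb
      -- With one component of sizes M and N, the formula reads 1/(MN) · 2MN · (1 - 1/2) = 1.
      simp only [treeFormula, Finset.prod_singleton, Finset.sum_singleton, ha, hb]
      field_simp
      norm_num
    · have hw : ∀ i ∈ s, 0 < fiberCard (fun x => π (Sum.inl x)) i * (Fintype.card V₂ : ℚ) +
          fiberCard (fun y => π (Sum.inr y)) i * (Fintype.card V₁ : ℚ) := by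
        intro i hi
        obtain ⟨v | v, rfl⟩ := h.exists_eq hi
        · exact add_pos_of_pos_of_nonneg
            (mul_pos (fiberCard_pos (fun x => π (Sum.inl x)) v) hN)
            (mul_nonneg (fiberCard_nonneg _ _) hM.le)
        · exact add_pos_of_nonneg_of_pos (mul_nonneg (fiberCard_nonneg _ _) hN.le)
            (mul_pos (fiberCard_pos (fun x => π (Sum.inr x)) v) hM)
      have hc : ((s.card : ℚ) - 1) ≠ 0 := by
        rw [hn]; push_cast; rw [add_sub_cancel_right]; exact_mod_cast hpos.ne'
      apply mul_left_cancel₀ hc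
      rw [card_sub_one_mul_numSpanningTreesContaining h,
        ← sum_mul_treeFormula_mergeAt hM.ne' hN.ne' hw ha hb]
      -- Weighting labels by fibre sizes turns the sum over label pairs into one over vertex pairs,
      -- to be compared termwise.
      simp only [← Finset.mul_sum]
      rw [← sum_comp_eq_sum_fiberCard_mul (fun x => π (Sum.inl x)) (fun x => h.mem _)]
      refine Finset.sum_congr rfl fun x _ => ?_
      rw [← sum_comp_eq_sum_fiberCard_mul (fun y => π (Sum.inr y)) (fun x => h.mem _)]
      refine Finset.sum_congr rfl fun y _ => ?_
      split_ifs with hxy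
      · rfl
      · have hcard : (s.erase (π (Sum.inr y))).card = n := by
          rw [Finset.card_erase_of_mem (h.mem _), hn]; rfl
        rw [ih (sup_le hle ((SimpleGraph.edge_le_iff _).2 (Or.inr (by simp))))
          (hF.sup_edge_of_not_reachable fun hr => hxy ((h.eq_iff _ _).2 hr)) (h.merge hxy) hcard]
        have hl := fun i (hi : i ∈ s.erase (π (Sum.inr y))) =>
          fiberCard_mergeLabel π (Sum.inl : V₁ → V₁ ⊕ V₂) hxy (Finset.mem_erase.1 hi).1
        have hr := fun i (hi : i ∈ s.erase (π (Sum.inr y))) =>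
          fiberCard_mergeLabel π (Sum.inr : V₂ → V₁ ⊕ V₂) hxy (Finset.mem_erase.1 hi).1
        unfold treeFormula
        rw [Finset.prod_congr rfl fun i hi => by rw [hl i hi, hr i hi],
          Finset.sum_congr rfl fun i hi => by rw [hl i hi, hr i hi]]

theorem numVertsIn_range_eq_fiberCard {V α : Type*} [Fintype α] {F : SimpleGraph V} (f : α → V)
    (hf : Function.Injective f) (p : F.ConnectedComponent) :
    (numVertsIn (Set.range f) p : ℚ) = fiberCard (fun x => F.connectedComponentMk (f x)) p := by
  classical
  rw [numVertsIn, fiberCard, ← Set.ncard_coe_finset, ← Set.ncard_image_of_injective _ hf]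
  congr 2
  ext v
  simp only [Set.mem_inter_iff, Set.mem_range, SimpleGraph.ConnectedComponent.mem_supp_iff,
    Finset.coe_filter, Finset.mem_univ, true_and, Set.mem_image, Set.mem_ofPred_eq]
  constructor
  · rintro ⟨⟨x, rfl⟩, hx⟩; exact ⟨x, hx, rfl⟩
  · rintro ⟨x, hx, rfl⟩; exact ⟨⟨x, rfl⟩, hx⟩

end Count

theorem mainTheorem2 {V₁ V₂ : Type*} [Fintype V₁] [Fintype V₂] [Nonempty V₁] [Nonempty V₂]
    (n₁ n₂ : ℕ) (hn₁ : Fintype.card V₁ = n₁) (hn₂ : Fintype.card V₂ = n₂)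
    (F : SimpleGraph (V₁ ⊕ V₂)) [Fintype F.ConnectedComponent]
    (hF : IsSpanningForest (completeBipartiteGraph V₁ V₂) F)
    (N₁ N₂ : F.ConnectedComponent → ℕ)
    (hN₁ : ∀ p, N₁ p = numVertsIn (Set.range Sum.inl) p)
    (hN₂ : ∀ p, N₂ p = numVertsIn (Set.range Sum.inr) p) :
    (numSpanningTreesContaining (completeBipartiteGraph V₁ V₂) F : ℚ) =
      1 / ((n₁ : ℚ) * n₂) *
        (∏ p, ((N₁ p : ℚ) * n₂ + (N₂ p : ℚ) * n₁)) *
        (1 - ∑ p, ((N₁ p : ℚ) * N₂ p) / ((N₁ p : ℚ) * n₂ + (N₂ p : ℚ) * n₁)) := by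
  subst hn₁ hn₂
  have h : IsComponentLabeling F Finset.univ F.connectedComponentMk :=
    { range_eq := by
        rw [Finset.coe_univ, Set.range_eq_univ]
        exact Quot.mk_surjective
      eq_iff := fun u v => SimpleGraph.ConnectedComponent.eq }
  rw [numSpanningTreesContaining_eq_treeFormula hF.1 hF.2 h, treeFormula]
  simp only [hN₁, hN₂, numVertsIn_range_eq_fiberCard _ Sum.inl_injective,
    numVertsIn_range_eq_fiberCard _ Sum.inr_injective]
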